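/- Let $X=\{0,1\}^{\mathbb Z}$ with the shift $\sigma$, $(\sigma x)_i=x_{i+1}$, let $M_\sigma(X)$ be the set of $\sigma$-invariant Borel probability measures with the weak-$*$ topology, and let $h$ denote Kolmogorov--Sinai entropy (natural logarithm). For a homeomorphism $T$ of a compact metrizable space and a continuous potential $\phi$, put $P(\phi)=\sup\{h(\nu)+\int\phi\,d\nu:\nu\in M_T\}$ and $\operatorname{Eq}(\phi)=\{\nu\in M_T: h(\nu)+\int\phi\,d\nu=P(\phi)\}$. Let $\mu$ be the Bernoulli$(1/2,1/2)$ measure on $X$. Then: (a) The entropy map $h$ is weak-$*$ upper semicontinuous on $M_\sigma(X)$. (b) There is a sequence $(\delta_n)$ of distinct periodic orbit measures (uniform measures on periodic orbits of $\sigma$) converging weak-$*$ to $\mu$. (c) For every such sequence, the set $\mathcal E=\{\delta_n\}_n\cup\{\mu\}$ consists of ergodic measures and is weak-$*$ closed; $h(\delta_n)=0$ for all $n$ and $h(\mu)=\log 2$, so that $h|_{\mathcal E}$ is not continuous; and there is no $\phi\in C(X)$ with $\operatorname{Eq}(\phi)=\overline{\operatorname{co}}(\mathcal E)$. (d) Consequently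 the following claim is false: for every homeomorphism $T$ of a compact metrizable space $Y$ whose entropy map is bounded and weak-$*$ upper semicontinuous on $M_T(Y)$, and every nonempty weak-$*$ closed set $\mathcal E$ of ergodic $T$-invariant probability measures, there is $\phi\in C(Y)$ with $\operatorname{Eq}(\phi)=\overline{\operatorname{co}}(\mathcal E)$. -/

import Mathlib

open MeasureTheory Set Filter Topology
open scoped NNReal ENNReal

noncomputable section

namespace Thermo

section General

variable {X : Type*} [MeasurableSpace X]

/-- Shannon entropy (natural logarithm) of the `n`-fold join `⋁_{i < n} T⁻ⁱ α`, where `α` is the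
finite partition `{f⁻¹(j)}` of `X` given by `f : X → Fin k`. The atoms of the join are indexed by
the words `w : Fin n → Fin k`. -/
def joinEntropy (T : X → X) (μ : ProbabilityMeasure X) {k : ℕ} (f : X → Fin k) (n : ℕ) : ℝ :=
  ∑ w : Fin n → Fin k, Real.negMulLog ((μ : Measure X).real {x | ∀ i : Fin n, f (T^[i] x) = w i})

/-- The entropy `h(μ, α) = lim (1/n) H(⋁_{i < n} T⁻ⁱ α)` of a finite partition. The limit exists
whenever `μ` is invariant; it is written as an upper limit, so that no junk value can occur. -/
def partitionEntropy (T : X → X) (μ : ProbabilityMeasure X) {k : ℕ} (f : X → Fin k) : EReal :=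
  limsup (fun n : ℕ => ((joinEntropy T μ f n / n : ℝ) : EReal)) atTop

/-- Kolmogorov–Sinai entropy: the supremum of `h(μ, α)` over all finite measurable partitions. -/
def entropy (T : X → X) (μ : ProbabilityMeasure X) : EReal :=
  ⨆ (k : ℕ) (f : X → Fin k) (_ : Measurable f), partitionEntropy T μ f

/-- The invariant Borel probability measures `M_T(X)`. -/
def invariantMeasures (T : X → X) : Set (ProbabilityMeasure X) :=
  {μ | MeasurePreserving T (μ : Measure X) (μ : Measure X)}

/-- The ergodic invariant Borel probability measures. -/
def ergodicMeasures (T : X → X) : Set (ProbabilityMeasure X) :=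
  {μ | Ergodic T (μ : Measure X)}

/-- `ν` is the uniform measure on a periodic orbit of `T`. -/
def IsPeriodicOrbitMeasure (T : X → X) (ν : ProbabilityMeasure X) : Prop :=
  ∃ (x : X) (p : ℕ), 0 < p ∧ Function.IsPeriodicPt T p x ∧
    (ν : Measure X) = (p : ℝ≥0∞)⁻¹ • ∑ i ∈ Finset.range p, Measure.dirac (T^[i] x)

variable [TopologicalSpace X]

/-- The pressure `P(φ) = sup {h(ν) + ∫ φ dν : ν ∈ M_T(X)}`. -/
def pressure (T : X → X) (φ : C(X, ℝ)) : EReal :=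
  ⨆ ν ∈ invariantMeasures T, entropy T ν + ((∫ x, φ x ∂(ν : Measure X) : ℝ) : EReal)

/-- The set `Eq(φ)` of equilibrium states of `φ`. -/
def equilibriumStates (T : X → X) (φ : C(X, ℝ)) : Set (ProbabilityMeasure X) :=
  {μ | μ ∈ invariantMeasures T ∧
    entropy T μ + ((∫ x, φ x ∂(μ : Measure X) : ℝ) : EReal) = pressure T φ}

/-- The weak-* closed convex hull of a set of probability measures. Convex combinations and the
closure are taken in the `ℝ≥0`-module of finite measures with its weak topology, of which the
probability measures form a closed convex subset with the induced topology. -/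
def closedConvexHull [OpensMeasurableSpace X] (E : Set (ProbabilityMeasure X)) :
    Set (ProbabilityMeasure X) :=
  {ν | ν.toFiniteMeasure ∈ closure (convexHull ℝ≥0 (ProbabilityMeasure.toFiniteMeasure '' E))}

end General

/-- The equilibrium-face realization claim without a continuity hypothesis on `h|_E`: for a
homeomorphism of a compact metrizable space with bounded and weak-* upper semicontinuous entropy
map, the closed convex hull of every nonempty weak-* closed set of ergodic measures is the set of
equilibrium states of a continuous potential. -/
def FaceRealization : Prop :=
  ∀ (X : Type) [TopologicalSpace X] [CompactSpace X] [TopologicalSpace.MetrizableSpace X]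
    [MeasurableSpace X] [BorelSpace X] (T : X ≃ₜ X),
    (∃ C : ℝ, ∀ ν ∈ invariantMeasures T, entropy T ν ≤ (C : EReal)) →
    UpperSemicontinuousOn (entropy T) (invariantMeasures T) →
    ∀ E : Set (ProbabilityMeasure X), E ⊆ ergodicMeasures T → E.Nonempty → IsClosed E →
      ∃ φ : C(X, ℝ), equilibriumStates T φ = closedConvexHull E

/-- The two-sided full shift on two symbols, `(σ x)_i = x_{i+1}`. -/
def shift : (ℤ → Fin 2) ≃ₜ (ℤ → Fin 2) where
  toFun x i := x (i + 1)
  invFun x i := x (i - 1)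
  left_inv x := by funext i; simp
  right_inv x := by funext i; simp
  continuous_toFun := by fun_prop
  continuous_invFun := by fun_prop

/-- The Bernoulli(1/2, 1/2) measure on the two-sided full shift. -/
def bernoulliHalf : ProbabilityMeasure (ℤ → Fin 2) :=
  ⟨Measure.infinitePi (fun _ : ℤ => (PMF.uniformOfFintype (Fin 2)).toMeasure), inferInstance⟩

end Thermo

end

namespace Thermo

/-! ### Shannon entropy of finite partitions. -/

section Shannon

open Real

/-! The obstruction is a jump of entropy along equilibrium states. If every `δ n` and the Bernoulli
measure were equilibrium states of `φ`, then `∫ φ dδ n` would equal the pressure, since `δ n` has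
zero entropy. By weak-* convergence the integral of `φ` against the limit is the pressure too, so
the limit has zero entropy; but its entropy is `log 2`. Only the inclusion of `E` in its closed
convex hull is needed.

Upper semicontinuity comes from block entropies. Every finite partition is approximated by one
depending on finitely many coordinates, so `h(ν) ≤ H_n(ν) / n` for every `n > 0`, with `H_n` the
entropy of `n` consecutive coordinates (`entropy_shift_le`). Each `H_n` is weak-* continuous because
cylinders are clopen, and `H_n / n` has upper limit at most `h`.

The periodic orbits are maximal-length shift register sequences: a linear form evaluated along the
powers of a generator of the unit group of the field with `2 ^ n` elements. One period shows each
nonzero word of length `n` exactly once, so cylinder masses converge to the Bernoulli ones with an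
explicit error. -/

lemma negMulLog_sum_le {ι : Type*} (s : Finset ι) (p : ι → ℝ) (hp : ∀ i ∈ s, 0 ≤ p i) :
    negMulLog (∑ i ∈ s, p i) ≤ ∑ i ∈ s, negMulLog (p i) := by
  rw [negMulLog, ← Finset.sum_neg_distrib, Finset.sum_mul]
  refine Finset.sum_le_sum fun i hi => ?_
  rw [negMulLog]
  rcases (hp i hi).eq_or_lt with h | h
  · simp [← h]
  · have : Real.log (p i) ≤ Real.log (∑ i ∈ s, p i) :=
      Real.log_le_log h (Finset.single_le_sum hp hi)
    nlinarith

/-- The tangent line of the concave function `negMulLog` at `1 / N`; summed over `N` atoms of total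
mass one it gives `log N`. -/
lemma negMulLog_le_inv_sub_add {x N : ℝ} (hx : 0 ≤ x) (hN : 0 < N) :
    negMulLog x ≤ N⁻¹ - x + x * Real.log N := by
  rcases hx.eq_or_lt with h | h
  · simp [← h, hN.le]
  · have h1 := Real.log_le_sub_one_of_pos (x := (x * N)⁻¹) (by positivity)
    rw [Real.log_inv, Real.log_mul h.ne' hN.ne'] at h1
    have h2 : x * (x * N)⁻¹ = N⁻¹ := by field_simp
    rw [negMulLog]
    nlinarith

/-- Subadditivity of Shannon entropy for an unnormalised joint distribution on a product. -/
lemma sum_negMulLog_add_negMulLog_le {α β : Type*} [Fintype α] [Fintype β] (q : α → β → ℝ)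
    (hq : ∀ a b, 0 ≤ q a b) :
    ∑ a, ∑ b, negMulLog (q a b) + negMulLog (∑ a, ∑ b, q a b) ≤
      ∑ a, negMulLog (∑ b, q a b) + ∑ b, negMulLog (∑ a, q a b) := by
  set r : α → ℝ := fun a => ∑ b, q a b with hr
  set c : β → ℝ := fun b => ∑ a, q a b with hc
  set t : ℝ := ∑ a, r a with ht
  have hct : ∑ b, c b = t := Finset.sum_comm
  have hr0 : ∀ a, 0 ≤ r a := fun a => Finset.sum_nonneg fun b _ => hq a b
  have hc0 : ∀ b, 0 ≤ c b := fun b => Finset.sum_nonneg fun a _ => hq a b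
  have ht0 : 0 ≤ t := Finset.sum_nonneg fun a _ => hr0 a
  -- This is `log s ≤ s - 1` at `s = r a * c b / (q a b * t)`. The error terms `r a * c b / t - q a
  -- b` sum to `t - t = 0`.
  have key : ∀ a b, negMulLog (q a b) + -(q a b * Real.log t) ≤
      -(q a b * Real.log (r a)) + -(q a b * Real.log (c b)) + (r a * c b / t - q a b) := by
    intro a b
    rcases (hq a b).eq_or_lt with h | h
    · rw [← h]
      have := div_nonneg (mul_nonneg (hr0 a) (hc0 b)) ht0
      simpa using this
    · have hra : 0 < r a :=
        h.trans_le (Finset.single_le_sum (fun b _ => hq a b) (Finset.mem_univ b))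
      have hcb : 0 < c b :=
        h.trans_le (Finset.single_le_sum (fun a _ => hq a b) (Finset.mem_univ a))
      have htp : 0 < t :=
        hra.trans_le (Finset.single_le_sum (fun a _ => hr0 a) (Finset.mem_univ a))
      have h1 := Real.log_le_sub_one_of_pos (x := r a * c b / (q a b * t)) (by positivity)
      rw [Real.log_div (by positivity) (by positivity), Real.log_mul hra.ne' hcb.ne',
        Real.log_mul h.ne' htp.ne'] at h1
      have h2 : q a b * (r a * c b / (q a b * t)) = r a * c b / t := by field_simp
      rw [negMulLog]
      nlinarith
  have hsum := Finset.sum_le_sum fun a (_ : a ∈ Finset.univ) =>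
    Finset.sum_le_sum fun b (_ : b ∈ Finset.univ) => key a b
  simp only [Finset.sum_add_distrib, Finset.sum_sub_distrib, Finset.sum_neg_distrib] at hsum
  have e1 : ∑ a, ∑ b, q a b * Real.log t = t * Real.log t := by
    simp only [← Finset.sum_mul]; rfl
  have e2 : ∑ a, ∑ b, q a b * Real.log (r a) = ∑ a, r a * Real.log (r a) := by
    simp only [← Finset.sum_mul]; rfl
  have e3 : ∑ a, ∑ b, q a b * Real.log (c b) = ∑ b, c b * Real.log (c b) := by
    rw [Finset.sum_comm]; simp only [← Finset.sum_mul]; rfl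
  have e4 : ∑ a, ∑ b, r a * c b / t = t := by
    simp only [← Finset.sum_div, ← Finset.mul_sum, hct, ← Finset.sum_mul]
    rw [← ht, mul_self_div_self]
  have e5 : ∑ a, ∑ b, q a b = t := rfl
  rw [e1, e2, e3, e4, e5] at hsum
  simp only [negMulLog, neg_mul, Finset.sum_neg_distrib] at hsum ⊢
  linarith

variable {X : Type*} [MeasurableSpace X] {ι κ τ : Type*}
  [Fintype ι] [MeasurableSpace ι] [MeasurableSingletonClass ι]
  [Fintype κ] [MeasurableSpace κ] [MeasurableSingletonClass κ]
  [Fintype τ] [MeasurableSpace τ] [MeasurableSingletonClass τ]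

/-- Shannon entropy of the finite partition of `X` into the fibres of `F`. -/
noncomputable def shannonEntropy {ι : Type*} [Fintype ι] (μ : Measure X) (F : X → ι) : ℝ :=
  ∑ a, negMulLog (μ.real (F ⁻¹' {a}))

lemma shannonEntropy_comp_measurePreserving {μ : Measure X} {T : X → X}
    (hT : MeasurePreserving T μ μ) {F : X → ι} (hF : Measurable F) :
    shannonEntropy μ (fun x => F (T x)) = shannonEntropy μ F := by
  refine Finset.sum_congr rfl fun a _ => ?_
  rw [show (fun x => F (T x)) ⁻¹' {a} = T ⁻¹' (F ⁻¹' {a}) from rfl,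
    hT.measureReal_preimage (hF (measurableSet_singleton a)).nullMeasurableSet]

variable (μ : Measure X) [IsProbabilityMeasure μ]

lemma shannonEntropy_nonneg {ι : Type*} [Fintype ι] (F : X → ι) : 0 ≤ shannonEntropy μ F :=
  Finset.sum_nonneg fun _ _ => negMulLog_nonneg measureReal_nonneg measureReal_le_one

lemma sum_measureReal_fibre {F : X → ι} (hF : Measurable F) :
    ∑ a, μ.real (F ⁻¹' {a}) = 1 := by
  rw [sum_measureReal_preimage_singleton _ fun a _ => hF (measurableSet_singleton a)]
  simp

lemma measureReal_comp_fibre {κ : Type*} [DecidableEq κ] {F : X → ι} (hF : Measurable F) (φ : ι → κ) (b : κ) :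
    μ.real ((fun x => φ (F x)) ⁻¹' {b}) = ∑ a with φ a = b, μ.real (F ⁻¹' {a}) := by
  rw [sum_measureReal_preimage_singleton _ fun a _ => hF (measurableSet_singleton a)]
  congr 1
  ext x
  simp

lemma shannonEntropy_comp_le {κ : Type*} [Fintype κ] {F : X → ι} (hF : Measurable F) (φ : ι → κ) :
    shannonEntropy μ (fun x => φ (F x)) ≤ shannonEntropy μ F := by
  classical
  unfold shannonEntropy
  rw [← Finset.sum_fiberwise Finset.univ φ (fun a => negMulLog (μ.real (F ⁻¹' {a})))]
  refine Finset.sum_le_sum fun b _ => ?_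
  rw [measureReal_comp_fibre μ hF φ b]
  exact negMulLog_sum_le _ _ fun _ _ => measureReal_nonneg

lemma shannonEntropy_le_log_card {F : X → ι} (hF : Measurable F) [Nonempty ι] :
    shannonEntropy μ F ≤ Real.log (Fintype.card ι) := by
  have hN : (0 : ℝ) < Fintype.card ι := by exact_mod_cast Fintype.card_pos
  calc shannonEntropy μ F ≤ ∑ a : ι, ((Fintype.card ι : ℝ)⁻¹ - μ.real (F ⁻¹' {a}) +
        μ.real (F ⁻¹' {a}) * Real.log (Fintype.card ι)) :=
        Finset.sum_le_sum fun a _ => negMulLog_le_inv_sub_add measureReal_nonneg hN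
    _ = Real.log (Fintype.card ι) := by
        rw [Finset.sum_add_distrib, Finset.sum_sub_distrib, ← Finset.sum_mul,
          sum_measureReal_fibre μ hF]
        simp [hN.ne']

/-- Subadditivity applied on each fibre of `K` to the unnormalised joint distribution of `F` and
`G`, then summed over the fibres. -/
lemma shannonEntropy_submodular {F : X → ι} {G : X → κ} {K : X → τ} (hF : Measurable F)
    (hG : Measurable G) (hK : Measurable K) :
    shannonEntropy μ (fun x => (F x, G x, K x)) + shannonEntropy μ K ≤
      shannonEntropy μ (fun x => (F x, K x)) + shannonEntropy μ (fun x => (G x, K x)) := by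
  classical
  set q : τ → ι → κ → ℝ := fun c a b => μ.real ((fun x => (F x, G x, K x)) ⁻¹' {(a, b, c)})
  have hJ : Measurable fun x => (F x, G x, K x) := by fun_prop
  have h1 : ∀ c, μ.real (K ⁻¹' {c}) = ∑ a, ∑ b, q c a b := by
    intro c
    have := measureReal_comp_fibre μ hJ (fun t => t.2.2) c
    simp only [] at this
    rw [show (fun x => K x) = K from rfl] at this
    rw [this, Finset.sum_filter, Fintype.sum_prod_type]
    refine Finset.sum_congr rfl fun a _ => ?_
    rw [Fintype.sum_prod_type]
    refine Finset.sum_congr rfl fun b _ => ?_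
    simp [q]
  have h2 : ∀ a c, μ.real ((fun x => (F x, K x)) ⁻¹' {(a, c)}) = ∑ b, q c a b := by
    intro a c
    have := measureReal_comp_fibre μ hJ (fun t => (t.1, t.2.2)) (a, c)
    simp only [] at this
    rw [this, Finset.sum_filter, Fintype.sum_prod_type]
    simp only [Fintype.sum_prod_type, Prod.mk.injEq, ite_and]
    simp [q, Finset.sum_ite_irrel]
  have h3 : ∀ b c, μ.real ((fun x => (G x, K x)) ⁻¹' {(b, c)}) = ∑ a, q c a b := by
    intro b c
    have := measureReal_comp_fibre μ hJ (fun t => (t.2.1, t.2.2)) (b, c)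
    simp only [] at this
    rw [this, Finset.sum_filter, Fintype.sum_prod_type]
    simp only [Fintype.sum_prod_type, Prod.mk.injEq, ite_and]
    simp [q]
  have hsum := Finset.sum_le_sum fun c (_ : c ∈ Finset.univ) =>
    sum_negMulLog_add_negMulLog_le (q c) fun _ _ => measureReal_nonneg
  simp only [Finset.sum_add_distrib] at hsum
  unfold shannonEntropy
  simp only [Fintype.sum_prod_type, h1, h2, h3]
  have e1 : ∑ a, ∑ b, ∑ c, negMulLog (μ.real ((fun x => (F x, G x, K x)) ⁻¹' {(a, b, c)})) =
      ∑ c, ∑ a, ∑ b, negMulLog (q c a b) := by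
    conv_rhs => rw [Finset.sum_comm]
    conv_rhs => enter [2, a]; rw [Finset.sum_comm]
  rw [e1, Finset.sum_comm (f := fun a c => negMulLog (∑ b, q c a b)),
    Finset.sum_comm (f := fun b c => negMulLog (∑ a, q c a b))]
  exact hsum

lemma shannonEntropy_prod_le {F : X → ι} {G : X → κ} (hF : Measurable F) (hG : Measurable G) :
    shannonEntropy μ (fun x => (F x, G x)) ≤ shannonEntropy μ F + shannonEntropy μ G := by
  have h := shannonEntropy_submodular μ hF hG (measurable_const (a := ()))
  have h0 := shannonEntropy_nonneg μ (fun _ : X => ())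
  have h1 := shannonEntropy_comp_le μ (F := fun x => (F x, G x, ())) (by fun_prop)
    (fun t => (t.1, t.2.1))
  have h2 := shannonEntropy_comp_le μ hF (fun t => (t, ()))
  have h3 := shannonEntropy_comp_le μ hG (fun t => (t, ()))
  linarith

/-- A finite partition that nearly coincides with a coarser one is nearly determined by it. -/
lemma exists_pos_shannonEntropy_prod_sub_le {ι : Type*} [Fintype ι] [DecidableEq ι]
    {η : ℝ} (hη : 0 < η) : ∃ ε > 0, ∀ {F G : X → ι},
      μ.real {x | F x ≠ G x} < ε →
      shannonEntropy μ (fun x => (F x, G x)) ≤ shannonEntropy μ G + η := by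
  set k : ℝ := (Fintype.card ι : ℝ) with hk
  have huc : UniformContinuousOn negMulLog (Set.Icc 0 1) :=
    isCompact_Icc.uniformContinuousOn_of_continuous continuous_negMulLog.continuousOn
  have hk0 : 0 ≤ k := by positivity
  -- The joint partition has `k * k` cells, each allowed this error; the `+ 1` covers `k = 0`.
  obtain ⟨ε, hε, huc⟩ := Metric.uniformContinuousOn_iff.1 huc (η / (k * k + 1)) (by positivity)
  refine ⟨ε, hε, fun {F G} hFG => ?_⟩
  have hI : ∀ s : Set X, μ.real s ∈ Set.Icc (0 : ℝ) 1 := fun s =>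
    ⟨measureReal_nonneg, measureReal_le_one⟩
  -- A diagonal cell differs from the fibre of `G` by less than `ε`; an off-diagonal cell lies in
  -- the disagreement set, so its mass is near `0`, where `negMulLog` vanishes.
  have hterm : ∀ a b, negMulLog (μ.real ((fun x => (F x, G x)) ⁻¹' {(a, b)})) ≤
      (if a = b then negMulLog (μ.real (G ⁻¹' {b})) else 0) + η / (k * k + 1) := by
    intro a b
    split_ifs with h
    · subst h
      have hsub : (fun x => (F x, G x)) ⁻¹' {(a, a)} ⊆ G ⁻¹' {a} := by
        intro x hx; simp only [mem_preimage, mem_singleton_iff, Prod.mk.injEq] at hx; exact hx.2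
      have hsub' : G ⁻¹' {a} ⊆ ((fun x => (F x, G x)) ⁻¹' {(a, a)}) ∪ {x | F x ≠ G x} := by
        intro x hx
        by_cases hxx : F x = G x
        · left; simp_all
        · right; exact hxx
      have h1 : μ.real ((fun x => (F x, G x)) ⁻¹' {(a, a)}) ≤ μ.real (G ⁻¹' {a}) :=
        measureReal_mono hsub
      have h2 : μ.real (G ⁻¹' {a}) ≤ μ.real ((fun x => (F x, G x)) ⁻¹' {(a, a)}) +
          μ.real {x | F x ≠ G x} := (measureReal_mono hsub').trans (measureReal_union_le _ _)
      have h3 := huc _ (hI ((fun x => (F x, G x)) ⁻¹' {(a, a)})) _ (hI (G ⁻¹' {a}))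
        (by rw [Real.dist_eq, abs_lt]; constructor <;> linarith)
      rw [Real.dist_eq, abs_lt] at h3
      linarith [h3.2]
    · have hsub : (fun x => (F x, G x)) ⁻¹' {(a, b)} ⊆ {x | F x ≠ G x} := by
        intro x hx
        simp only [mem_preimage, mem_singleton_iff, Prod.mk.injEq] at hx
        simp [hx.1, hx.2, h]
      have h1 : μ.real ((fun x => (F x, G x)) ⁻¹' {(a, b)}) ≤ μ.real {x | F x ≠ G x} :=
        measureReal_mono hsub
      have h3 := huc _ (hI ((fun x => (F x, G x)) ⁻¹' {(a, b)})) 0 (by simp)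
        (by rw [Real.dist_eq, sub_zero, abs_of_nonneg measureReal_nonneg]; linarith)
      rw [Real.dist_eq, abs_lt, negMulLog_zero] at h3
      linarith [h3.2]
  unfold shannonEntropy
  rw [Fintype.sum_prod_type]
  calc _ ≤ ∑ a : ι, ∑ b : ι, ((if a = b then negMulLog (μ.real (G ⁻¹' {b})) else 0) +
        η / (k * k + 1)) := Finset.sum_le_sum fun a _ => Finset.sum_le_sum fun b _ => hterm a b
    _ = ∑ a, negMulLog (μ.real (G ⁻¹' {a})) + k * k * (η / (k * k + 1)) := by
        simp [Finset.sum_add_distrib, hk, mul_assoc]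
    _ ≤ _ := by
        gcongr
        rw [mul_div_assoc', div_le_iff₀ (by positivity)]
        nlinarith

end Shannon

/-! ### Entropy of joins: subadditivity and change of partition. -/

section JoinEntropy

variable {X : Type*} [MeasurableSpace X]

lemma joinEntropy_eq_shannonEntropy (T : X → X) (μ : ProbabilityMeasure X) {k : ℕ}
    (f : X → Fin k) (n : ℕ) :
    joinEntropy T μ f n = shannonEntropy (μ : Measure X) (fun x (i : Fin n) => f (T^[i] x)) := by
  refine Finset.sum_congr rfl fun w _ => ?_
  congr 2
  ext x
  simp [funext_iff]

lemma measurable_itinerary {T : X → X} (hT : Measurable T) {k : ℕ} {f : X → Fin k}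
    (hf : Measurable f) (n : ℕ) : Measurable fun x (i : Fin n) => f (T^[i] x) :=
  measurable_pi_lambda _ fun i => hf.comp (hT.iterate i)

lemma joinEntropy_nonneg (T : X → X) (μ : ProbabilityMeasure X) {k : ℕ} (f : X → Fin k) (n : ℕ) :
    0 ≤ joinEntropy T μ f n := by
  rw [joinEntropy_eq_shannonEntropy]
  exact shannonEntropy_nonneg _ _

lemma partitionEntropy_nonneg (T : X → X) (μ : ProbabilityMeasure X) {k : ℕ} (f : X → Fin k) :
    0 ≤ partitionEntropy T μ f := by
  refine le_limsup_of_frequently_le (Eventually.frequently (Eventually.of_forall fun n => ?_))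
  exact_mod_cast div_nonneg (joinEntropy_nonneg T μ f n) n.cast_nonneg

lemma entropy_nonneg (T : X → X) (μ : ProbabilityMeasure X) : 0 ≤ entropy T μ :=
  (partitionEntropy_nonneg T μ fun _ => (0 : Fin 1)).trans
    (le_iSup_of_le 1 (le_iSup_of_le _ (le_iSup_of_le measurable_const le_rfl)))

lemma partitionEntropy_le_entropy (T : X → X) (μ : ProbabilityMeasure X) {k : ℕ} {f : X → Fin k}
    (hf : Measurable f) : partitionEntropy T μ f ≤ entropy T μ :=
  le_iSup_of_le k (le_iSup_of_le f (le_iSup_of_le hf le_rfl))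

variable {T : X → X} {μ : ProbabilityMeasure X}

/-- An itinerary of length `m + n` concatenates two shorter ones, and by invariance the later one
has the entropy of an initial one. -/
lemma subadditive_joinEntropy (hμ : μ ∈ invariantMeasures T) {k : ℕ} {f : X → Fin k}
    (hf : Measurable f) : Subadditive (joinEntropy T μ f) := by
  intro m n
  have hT : MeasurePreserving T (μ : Measure X) (μ : Measure X) := hμ
  simp only [joinEntropy_eq_shannonEntropy]
  have hm := measurable_itinerary hT.measurable hf m
  have hn := measurable_itinerary hT.measurable hf n
  have hn' := hn.comp (hT.measurable.iterate m)
  rw [← shannonEntropy_comp_measurePreserving (hT.iterate m) hn]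
  refine le_trans ?_ (shannonEntropy_prod_le _ hm hn')
  refine le_trans (le_of_eq ?_) (shannonEntropy_comp_le _ (hm.prodMk hn')
    (fun p => Fin.append p.1 p.2))
  congr 1
  funext x i
  refine Fin.addCases (fun i => ?_) (fun i => ?_) i
  · simp
  · simp [← Function.iterate_add_apply, add_comm]

lemma bddBelow_joinEntropy_div (T : X → X) (μ : ProbabilityMeasure X) {k : ℕ} (f : X → Fin k) :
    BddBelow (range fun n : ℕ => joinEntropy T μ f n / n) :=
  ⟨0, by rintro _ ⟨n, rfl⟩; exact div_nonneg (joinEntropy_nonneg T μ f n) n.cast_nonneg⟩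

/-- Changing the partition changes the entropy of each join at most linearly, with slope the
conditional entropy of one partition given the other. -/
lemma joinEntropy_le_add_mul (hμ : μ ∈ invariantMeasures T) {k l : ℕ} {f : X → Fin k}
    {g : X → Fin l} (hf : Measurable f) (hg : Measurable g) (n : ℕ) :
    joinEntropy T μ f n ≤ joinEntropy T μ g n + n *
      (shannonEntropy (μ : Measure X) (fun x => (f x, g x)) - shannonEntropy (μ : Measure X) g) := by
  have hT : MeasurePreserving T (μ : Measure X) (μ : Measure X) := hμ
  set c := shannonEntropy (μ : Measure X) (fun x => (f x, g x)) - shannonEntropy (μ : Measure X) g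
    with hc
  simp only [joinEntropy_eq_shannonEntropy]
  have hF := measurable_itinerary hT.measurable hf
  have hG := measurable_itinerary hT.measurable hg
  have hTi := fun n => hT.measurable.iterate n
  -- The induction runs on the joint itinerary of `f` and `g`, which dominates that of `f` alone.
  suffices h : shannonEntropy (μ : Measure X)
      (fun x => ((fun i : Fin n => f (T^[i] x)), (fun i : Fin n => g (T^[i] x)))) ≤
      shannonEntropy (μ : Measure X) (fun x (i : Fin n) => g (T^[i] x)) + n * c from
    (shannonEntropy_comp_le _ ((hF n).prodMk (hG n)) Prod.fst).trans h
  induction n with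
  | zero =>
    have := shannonEntropy_comp_le (μ : Measure X) (hG 0)
      (fun w => ((fun i : Fin 0 => i.elim0 : Fin 0 → Fin k), w))
    rw [Nat.cast_zero, zero_mul, add_zero]
    refine le_trans (le_of_eq ?_) this
    congr 1
    funext x
    exact Prod.ext (Subsingleton.elim _ _) rfl
  | succ n ih =>
    have ha : Measurable fun x => f (T^[n] x) := hf.comp (hTi n)
    have hb : Measurable fun x => g (T^[n] x) := hg.comp (hTi n)
    -- Given the new symbol of `g`, the new symbol of `f` costs at most `c` (`s1`). Given the past
    -- of `g`, adding the past of `f` makes the new symbol of `g` no costlier (`s2`).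
    have s1 := shannonEntropy_submodular (μ : Measure X) ha ((hF n).prodMk (hG n)) hb
    have s2 := shannonEntropy_submodular (μ : Measure X) (hF n) hb (hG n)
    have i1 := shannonEntropy_comp_measurePreserving (hT.iterate n) hg
    have i2 := shannonEntropy_comp_measurePreserving (hT.iterate n) (hf.prodMk hg)
    have c1 := shannonEntropy_comp_le (μ : Measure X) (ha.prodMk (((hF n).prodMk (hG n)).prodMk hb))
      (fun t : Fin k × ((Fin n → Fin k) × (Fin n → Fin l)) × Fin l =>
        ((Fin.snoc t.2.1.1 t.1 : Fin (n + 1) → Fin k),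
          (Fin.snoc t.2.1.2 t.2.2 : Fin (n + 1) → Fin l)))
    have c2 := shannonEntropy_comp_le (μ : Measure X) ((hF n).prodMk (hb.prodMk (hG n)))
      (fun t => ((t.1, t.2.2), t.2.1))
    have c3 := shannonEntropy_comp_le (μ : Measure X) (hG (n + 1))
      (fun w => (w (Fin.last n), fun i : Fin n => w i.castSucc))
    have e1 : (fun x => ((Fin.snoc (fun i : Fin n => f (T^[i] x)) (f (T^[n] x)) :
          Fin (n + 1) → Fin k), (Fin.snoc (fun i : Fin n => g (T^[i] x)) (g (T^[n] x)) :
          Fin (n + 1) → Fin l))) =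
        fun x => ((fun i : Fin (n + 1) => f (T^[i] x)), (fun i : Fin (n + 1) => g (T^[i] x))) := by
      funext x
      refine Prod.ext (funext fun i => ?_) (funext fun i => ?_) <;>
      · refine Fin.lastCases ?_ (fun i => ?_) i <;> simp
    simp only [e1] at c1
    simp only [Fin.val_last, Fin.val_castSucc] at c3
    push_cast
    linarith

end JoinEntropy

/-! ### Approximation by finitely many coordinates. -/

section Window

lemma shift_iterate_apply (n : ℕ) (x : ℤ → Fin 2) (j : ℤ) : shift^[n] x j = x (j + n) := by
  induction n generalizing x with
  | zero => simp
  | succ n ih =>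
    rw [Function.iterate_succ_apply, ih]
    change x (j + n + 1) = _
    push_cast
    ring_nf

/-- The coordinates of `x` with index in `[-m, m]`. -/
def window (m : ℕ) (x : ℤ → Fin 2) : Fin (2 * m + 1) → Fin 2 := fun i => x (i - m)

lemma measurable_window (m : ℕ) : Measurable (window m) :=
  measurable_pi_lambda _ fun _ => measurable_pi_apply _

lemma eq_of_window_eq {m : ℕ} {x y : ℤ → Fin 2} (h : window m x = window m y) {j : ℤ}
    (h1 : -m ≤ j) (h2 : j ≤ m) : x j = y j := by
  have := congrFun h ⟨(j + m).toNat, by omega⟩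
  have e : (((j + m).toNat : ℕ) : ℤ) - m = j := by omega
  simpa only [window, e] using this

lemma exists_window_preimage {m : ℕ} {t : Set (ℤ → Fin 2)}
    (h : ∀ x y, window m x = window m y → x ∈ t → y ∈ t) : ∃ S, t = window m ⁻¹' S := by
  refine ⟨window m '' t, subset_antisymm (subset_preimage_image _ _) ?_⟩
  rintro y ⟨x, hx, hxy⟩
  exact h x y hxy hx

lemma exists_window_preimage_of_le {m M : ℕ} (hmM : m ≤ M) (S : Set (Fin (2 * m + 1) → Fin 2)) :
    ∃ S', window m ⁻¹' S = window M ⁻¹' S' := by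
  refine exists_window_preimage fun x y hxy hx => ?_
  have : window m x = window m y :=
    funext fun i => eq_of_window_eq hxy (by omega) (by omega)
  rwa [mem_preimage, ← this]

lemma exists_window_preimage_of_mem_measurableCylinders {t : Set (ℤ → Fin 2)}
    (ht : t ∈ measurableCylinders fun _ : ℤ => Fin 2) : ∃ m S, t = window m ⁻¹' S := by
  obtain ⟨s, S, -, rfl⟩ := (mem_measurableCylinders _).1 ht
  refine ⟨s.sup Int.natAbs, exists_window_preimage fun x y hxy hx => ?_⟩
  rw [mem_cylinder] at hx ⊢
  have : s.restrict y = s.restrict x := by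
    funext i
    have := Finset.le_sup (f := Int.natAbs) i.2
    exact (eq_of_window_eq hxy (by omega) (by omega)).symm
  rwa [this]

lemma isClopen_window_preimage (m : ℕ) (S : Set (Fin (2 * m + 1) → Fin 2)) :
    IsClopen (window m ⁻¹' S) :=
  (isClopen_discrete S).preimage (continuous_pi fun _ => continuous_apply _)

variable (μ : Measure (ℤ → Fin 2)) [IsProbabilityMeasure μ]

lemma exists_window_symmDiff_lt {A : Set (ℤ → Fin 2)} (hA : MeasurableSet A) {ε : ℝ}
    (hε : 0 < ε) : ∃ m S, μ.real (symmDiff (window m ⁻¹' S) A) < ε := by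
  obtain ⟨t, ht, htA⟩ := exists_measure_symmDiff_lt_of_generateFrom_isSetRing (μ := μ)
    (isSetAlgebra_measurableCylinders (α := fun _ : ℤ => Fin 2)).isSetRing
    ⟨{univ}, countable_singleton _, singleton_subset_iff.2 (univ_mem_measurableCylinders _), by simp⟩
    generateFrom_measurableCylinders.symm hA (ENNReal.ofReal_pos.2 hε)
  obtain ⟨m, S, rfl⟩ := exists_window_preimage_of_mem_measurableCylinders ht
  exact ⟨m, S, (ENNReal.lt_ofReal_iff_toReal_lt (measure_ne_top _ _)).1 htA⟩

lemma exists_window_comp_ne_lt {k : ℕ} {f : (ℤ → Fin 2) → Fin k} (hf : Measurable f) {ε : ℝ}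
    (hε : 0 < ε) : ∃ (m : ℕ) (G : (Fin (2 * m + 1) → Fin 2) → Fin k),
      μ.real {x | f x ≠ G (window m x)} < ε := by
  classical
  have hf' : ∀ j, MeasurableSet (f ⁻¹' {j}) := fun j => hf (measurableSet_singleton j)
  choose m₀ S₀ hS₀ using fun j =>
    exists_window_symmDiff_lt μ (hf' j) (ε := ε / (k + 1)) (by positivity)
  set m := Finset.univ.sup m₀
  choose S hS using fun j =>
    exists_window_preimage_of_le (Finset.le_sup (f := m₀) (Finset.mem_univ j)) (S₀ j)
  -- Off the symmetric differences exactly one `S j` contains the window, so the choice returns `f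
  -- x`. The value `f 0`, at the zero sequence, is a mere default.
  refine ⟨m, fun w => if h : ∃ j, w ∈ S j then h.choose else f 0, ?_⟩
  have hsub : {x | f x ≠ if h : ∃ j, window m x ∈ S j then h.choose else f 0} ⊆
      ⋃ j ∈ (Finset.univ : Finset (Fin k)), symmDiff (window (m₀ j) ⁻¹' S₀ j) (f ⁻¹' {j}) := by
    intro x hx
    by_contra hcon
    simp only [mem_iUnion, Finset.mem_univ, exists_true_left, not_exists] at hcon
    have hiff : ∀ j, window m x ∈ S j ↔ f x = j := by
      intro j
      have := hcon j
      rw [hS j, Set.mem_symmDiff] at this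
      simp only [mem_preimage, mem_singleton_iff] at this
      tauto
    apply hx
    have h : ∃ j, window m x ∈ S j := ⟨f x, (hiff _).2 rfl⟩
    rw [dif_pos h]
    exact (hiff _).1 h.choose_spec
  calc _ ≤ _ := measureReal_mono hsub (measure_ne_top _ _)
    _ ≤ ∑ j : Fin k, _ := measureReal_biUnion_finset_le _ _
    _ ≤ ∑ j : Fin k, ε / (k + 1) := Finset.sum_le_sum fun j _ => (hS₀ j).le
    _ = k * (ε / (k + 1)) := by simp
    _ < ε := by
      rw [mul_div_assoc', div_lt_iff₀ (by positivity)]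
      nlinarith

end Window

/-! ### The generating partition and upper semicontinuity. -/

section KolmogorovSinai

/-- The coordinate map at the origin, whose fibres form the standard generating partition. -/
def originCoord (x : ℤ → Fin 2) : Fin 2 := x 0

lemma measurable_originCoord : Measurable originCoord := measurable_pi_apply 0

variable {ν : ProbabilityMeasure (ℤ → Fin 2)}

/-- The first `n` windows see only the coordinates from `-m` to `n - 1 + m`; shifting by `m` turns
these into the first `n + 2 * m` nonnegative ones. -/
lemma joinEntropy_window_comp_le (hν : ν ∈ invariantMeasures shift) {k m : ℕ}
    (G : (Fin (2 * m + 1) → Fin 2) → Fin k) (n : ℕ) :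
    joinEntropy shift ν (fun x => G (window m x)) n ≤
      joinEntropy shift ν originCoord (n + 2 * m) := by
  have hT : MeasurePreserving shift (ν : Measure (ℤ → Fin 2)) (ν : Measure (ℤ → Fin 2)) := hν
  have hG : Measurable fun x => G (window m x) :=
    (measurable_of_finite G).comp (measurable_window m)
  simp only [joinEntropy_eq_shannonEntropy]
  rw [← shannonEntropy_comp_measurePreserving (hT.iterate m)
    (measurable_itinerary hT.measurable hG n)]
  refine le_trans (le_of_eq ?_) (shannonEntropy_comp_le _
    (measurable_itinerary hT.measurable measurable_originCoord (n + 2 * m))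
    (fun w (i : Fin n) => G fun j => w ⟨i + j, by omega⟩))
  congr 1
  funext x i
  congr 1
  funext j
  simp only [window, originCoord, shift_iterate_apply]
  congr 1
  push_cast
  ring

/-- The entropy of an invariant measure of the full shift is at most the normalised entropy of each
finite block of coordinates. -/
lemma entropy_shift_le (hν : ν ∈ invariantMeasures shift) {n : ℕ} (hn : n ≠ 0) :
    entropy shift ν ≤ ((joinEntropy shift ν originCoord n / n : ℝ) : EReal) := by
  have hsub := subadditive_joinEntropy hν measurable_originCoord
  have hbdd := bddBelow_joinEntropy_div shift ν originCoord
  have hle := hsub.lim_le_div hbdd hn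
  have hlim := hsub.tendsto_lim hbdd
  refine iSup_le fun k => iSup_le fun f => iSup_le fun hf => ?_
  refine EReal.le_of_forall_lt_iff_le.1 fun z hz => ?_
  -- By Fekete the limit of `H_N / N` is below each `H_n / n`; the slack `z - hsub.lim` is what
  -- replacing `f` by a window partition may cost per step.
  have hz' : hsub.lim < z := hle.trans_lt (EReal.coe_lt_coe_iff.1 hz)
  obtain ⟨ε, hε, happ⟩ := exists_pos_shannonEntropy_prod_sub_le (ν : Measure (ℤ → Fin 2))
    (ι := Fin k) (sub_pos.2 hz')
  obtain ⟨m, G, hG⟩ := exists_window_comp_ne_lt (ν : Measure (ℤ → Fin 2)) hf hε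
  have hGm : Measurable fun x => G (window m x) :=
    (measurable_of_finite G).comp (measurable_window m)
  have hfG := happ hG
  have hup : Tendsto (fun N : ℕ => joinEntropy shift ν originCoord N / N +
      joinEntropy shift ν originCoord (2 * m) / N + (z - hsub.lim)) atTop (𝓝 z) := by
    have := (hlim.add (tendsto_const_div_atTop_nhds_zero_nat
      (joinEntropy shift ν originCoord (2 * m)))).add_const (z - hsub.lim)
    simpa using this
  have hup' := (continuous_coe_real_ereal.tendsto z).comp hup
  rw [← hup'.limsup_eq]
  refine limsup_le_limsup ?_
  filter_upwards [eventually_gt_atTop 0] with N hN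
  have hN' : (0 : ℝ) < N := by exact_mod_cast hN
  simp only [Function.comp_apply, EReal.coe_le_coe_iff]
  have h1 := joinEntropy_le_add_mul hν hf hGm N
  have h2 := joinEntropy_window_comp_le hν G N
  have h3 := hsub N (2 * m)
  rw [← add_div, div_add' _ _ _ hN'.ne']
  gcongr
  nlinarith

lemma entropy_shift_le_log_two (hν : ν ∈ invariantMeasures shift) :
    entropy shift ν ≤ ((Real.log 2 : ℝ) : EReal) := by
  refine (entropy_shift_le hν one_ne_zero).trans ?_
  have h := shannonEntropy_le_log_card (ν : Measure (ℤ → Fin 2))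
    (measurable_itinerary shift.continuous.measurable measurable_originCoord 1)
  rw [← joinEntropy_eq_shannonEntropy] at h
  simpa using h

lemma continuous_joinEntropy_originCoord (n : ℕ) :
    Continuous fun ν => joinEntropy shift ν originCoord n := by
  refine continuous_finsetSum _ fun w _ => Real.continuous_negMulLog.comp ?_
  refine continuous_iff_continuousAt.2 fun ν => ?_
  have hcl : IsClopen {x : ℤ → Fin 2 | ∀ i : Fin n, originCoord (shift^[i] x) = w i} := by
    have hc : Continuous fun (x : ℤ → Fin 2) (i : Fin n) => originCoord (shift^[i] x) :=
      continuous_pi fun i => (continuous_apply 0).comp (shift.continuous.iterate i)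
    convert! (isClopen_discrete {w}).preimage hc using 1
    ext x
    simp [funext_iff]
  exact (NNReal.continuous_coe.tendsto _).comp
    (ProbabilityMeasure.tendsto_measure_of_isClopen_of_tendsto tendsto_id hcl)

lemma upperSemicontinuousOn_entropy_shift :
    UpperSemicontinuousOn (entropy shift) (invariantMeasures shift) := by
  intro ν hν y hy
  have h1 : limsup (fun n : ℕ => ((joinEntropy shift ν originCoord n / n : ℝ) : EReal)) atTop < y :=
    (partitionEntropy_le_entropy shift ν measurable_originCoord).trans_lt hy
  obtain ⟨n, hn, hny⟩ := ((eventually_lt_of_limsup_lt h1).and (eventually_gt_atTop 0)).exists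
  have hc : Continuous fun ν => ((joinEntropy shift ν originCoord n / n : ℝ) : EReal) :=
    continuous_coe_real_ereal.comp ((continuous_joinEntropy_originCoord n).div_const _)
  filter_upwards [mem_nhdsWithin_of_mem_nhds (hc.continuousAt.eventually_lt_const hn),
    self_mem_nhdsWithin] with ν' h h'
  exact (entropy_shift_le h' hny.ne').trans_lt h

end KolmogorovSinai

/-! ### Periodic orbit measures. -/

section PeriodicOrbit

variable {X : Type*} [MeasurableSpace X] {T : X → X} {ν : ProbabilityMeasure X} {x : X} {p : ℕ}

lemma orbitMeasure_apply
    (h : (ν : Measure X) = (p : ℝ≥0∞)⁻¹ • ∑ i ∈ Finset.range p, Measure.dirac (T^[i] x))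
    {s : Set X} (hs : MeasurableSet s) :
    (ν : Measure X) s = (p : ℝ≥0∞)⁻¹ * ∑ i ∈ Finset.range p, s.indicator 1 (T^[i] x) := by
  simp [h, Measure.dirac_apply' _ hs]

lemma orbitMeasure_real_apply
    (h : (ν : Measure X) = (p : ℝ≥0∞)⁻¹ • ∑ i ∈ Finset.range p, Measure.dirac (T^[i] x))
    {s : Set X} [DecidablePred fun i => T^[i] x ∈ s] (hs : MeasurableSet s) :
    (ν : Measure X).real s = (p : ℝ)⁻¹ * (Finset.card {i ∈ Finset.range p | T^[i] x ∈ s} : ℝ) := by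
  classical
  rw [Measure.real, orbitMeasure_apply h hs]
  simp [Set.indicator_apply]

lemma IsPeriodicOrbitMeasure.mem_invariantMeasures (hT : Measurable T)
    (h : IsPeriodicOrbitMeasure T ν) : ν ∈ invariantMeasures T := by
  obtain ⟨x, p, -, hx, hν⟩ := h
  refine ⟨hT, Measure.ext fun s hs => ?_⟩
  rw [Measure.map_apply hT hs, orbitMeasure_apply hν (hT hs), orbitMeasure_apply hν hs]
  congr 1
  -- The sum over times `0` to `p` is split at either end; periodicity makes the two end terms
  -- equal, and being finite they cancel.
  have h1 := Finset.sum_range_succ (fun i => s.indicator (1 : X → ℝ≥0∞) (T^[i] x)) p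
  rw [Finset.sum_range_succ', hx.eq] at h1
  simp only [Function.iterate_zero, id] at h1
  rw [← ENNReal.add_left_inj (a := s.indicator (1 : X → ℝ≥0∞) x)
    (by by_cases hxs : x ∈ s <;> simp [hxs]), ← h1]
  simp only [Function.iterate_succ_apply']
  rfl

lemma IsPeriodicOrbitMeasure.mem_ergodicMeasures (hT : Measurable T)
    (h : IsPeriodicOrbitMeasure T ν) : ν ∈ ergodicMeasures T := by
  refine ⟨h.mem_invariantMeasures hT, ⟨fun s hs hinv => ?_⟩⟩
  obtain ⟨x, p, -, -, hν⟩ := h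
  have hiff : ∀ i, T^[i] x ∈ s ↔ x ∈ s := by
    intro i
    induction i with
    | zero => rfl
    | succ i ih => rw [← ih, Function.iterate_succ_apply', ← mem_preimage (f := T), hinv]
  rw [eventuallyConst_set']
  by_cases hxs : x ∈ s
  · right
    rw [ae_eq_univ, orbitMeasure_apply hν hs.compl]
    simp [hiff, hxs]
  · left
    rw [ae_eq_empty, orbitMeasure_apply hν hs]
    simp [hiff, hxs]

/-- Every set has mass zero or at least `1 / p`, so all joins have entropy at most `log p`,
uniformly in their length. -/
lemma IsPeriodicOrbitMeasure.entropy_eq_zero (hT : Measurable T)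
    (h : IsPeriodicOrbitMeasure T ν) : entropy T ν = 0 := by
  classical
  refine le_antisymm (iSup_le fun k => iSup_le fun f => iSup_le fun hf => ?_) (entropy_nonneg T ν)
  obtain ⟨x, p, hp, -, hν⟩ := h
  have hp' : (0 : ℝ) < p := by exact_mod_cast hp
  have hterm : ∀ s : Set X, MeasurableSet s →
      Real.negMulLog ((ν : Measure X).real s) ≤ (ν : Measure X).real s * Real.log p := by
    intro s hs
    rw [orbitMeasure_real_apply hν hs]
    rcases Nat.eq_zero_or_pos (Finset.card {i ∈ Finset.range p | T^[i] x ∈ s}) with h0 | h0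
    · simp [h0]
    · have h1 : (1 : ℝ) ≤ (Finset.card {i ∈ Finset.range p | T^[i] x ∈ s} : ℝ) := by
        exact_mod_cast h0
      have h2 := Real.log_nonneg h1
      rw [Real.negMulLog, Real.log_mul (by positivity) (by positivity), Real.log_inv]
      have : 0 ≤ (p : ℝ)⁻¹ * (Finset.card {i ∈ Finset.range p | T^[i] x ∈ s} : ℝ) := by positivity
      nlinarith
  have hbound : ∀ n, joinEntropy T ν f n ≤ Real.log p := by
    intro n
    have hF := measurable_itinerary hT hf n
    rw [joinEntropy_eq_shannonEntropy]
    calc _ ≤ _ := Finset.sum_le_sum fun w _ => hterm _ (hF (measurableSet_singleton w))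
      _ = Real.log p := by rw [← Finset.sum_mul, sum_measureReal_fibre _ hF, one_mul]
  have hlim := (continuous_coe_real_ereal.tendsto 0).comp
    (tendsto_const_div_atTop_nhds_zero_nat (Real.log p))
  rw [← EReal.coe_zero, ← hlim.limsup_eq]
  refine limsup_le_limsup (Eventually.of_forall fun n => ?_)
  simp only [Function.comp_apply, EReal.coe_le_coe_iff]
  have := hbound n
  gcongr

end PeriodicOrbit

/-! ### Entropy and ergodicity of the Bernoulli measure. -/

section Bernoulli

lemma bernoulliHalf_map_comp {α : Type*} {e : α → ℤ} (he : Function.Injective e) :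
    (bernoulliHalf : Measure (ℤ → Fin 2)).map (fun x i => x (e i)) =
      Measure.infinitePi fun _ : α => (PMF.uniformOfFintype (Fin 2)).toMeasure :=
  Measure.map_infinitePi_infinitePi_of_inj
    (P := fun _ : ℤ => (PMF.uniformOfFintype (Fin 2)).toMeasure) he

lemma bernoulliHalf_real_singleton {α : Type*} [Fintype α] {e : α → ℤ}
    (he : Function.Injective e) (w : α → Fin 2) :
    (bernoulliHalf : Measure (ℤ → Fin 2)).real ((fun x i => x (e i)) ⁻¹' {w}) =
      ((2 : ℝ) ^ Fintype.card α)⁻¹ := by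
  rw [Measure.real, ← Measure.map_apply (by fun_prop) (measurableSet_singleton w),
    bernoulliHalf_map_comp he, Measure.infinitePi_singleton_of_fintype]
  simp

lemma bernoulliHalf_mem_invariantMeasures : bernoulliHalf ∈ invariantMeasures shift :=
  ⟨shift.continuous.measurable, bernoulliHalf_map_comp (add_left_injective (1 : ℤ))⟩

lemma entropy_bernoulliHalf : entropy shift bernoulliHalf = ((Real.log 2 : ℝ) : EReal) := by
  refine le_antisymm (entropy_shift_le_log_two bernoulliHalf_mem_invariantMeasures) ?_
  refine le_trans ?_ (partitionEntropy_le_entropy shift bernoulliHalf measurable_originCoord)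
  have hJ : ∀ n : ℕ, joinEntropy shift bernoulliHalf originCoord n = n * Real.log 2 := by
    intro n
    rw [joinEntropy_eq_shannonEntropy]
    have e1 : (fun x (i : Fin n) => originCoord (shift^[i] x)) = fun x i => x ((i : ℕ) : ℤ) := by
      funext x i
      simp [originCoord, shift_iterate_apply]
    have hinj : Function.Injective fun i : Fin n => ((i : ℕ) : ℤ) := fun i j h => by
      ext; simpa using h
    simp only [e1, shannonEntropy, bernoulliHalf_real_singleton hinj]
    simp [Real.negMulLog]
  refine le_of_eq ?_
  refine (Tendsto.limsup_eq ((continuous_coe_real_ereal.tendsto _).comp ?_)).symm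
  refine tendsto_const_nhds.congr' ?_
  filter_upwards [eventually_gt_atTop 0] with n hn
  have hn' : (n : ℝ) ≠ 0 := by exact_mod_cast hn.ne'
  rw [hJ]
  field_simp

/-- A shift by the window length `2 * m + 1` moves `[-m, m]` to the disjoint interval `[m + 1, 3 * m
+ 1]`, so the two events are independent. -/
lemma bernoulliHalf_real_inter (m : ℕ) (S : Set (Fin (2 * m + 1) → Fin 2)) :
    (bernoulliHalf : Measure (ℤ → Fin 2)).real
      (window m ⁻¹' S ∩ shift^[2 * m + 1] ⁻¹' (window m ⁻¹' S)) =
      (bernoulliHalf : Measure (ℤ → Fin 2)).real (window m ⁻¹' S) ^ 2 := by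
  have hind := (ProbabilityTheory.iIndepFun_infinitePi
    (P := fun _ : ℤ => (PMF.uniformOfFintype (Fin 2)).toMeasure)
    (X := fun _ ω => ω) fun _ => measurable_id).indepFun_finset
    (Finset.Icc (-m : ℤ) m) (Finset.Icc (m + 1 : ℤ) (3 * m + 1))
    (by
      rw [Finset.disjoint_left]
      intro a ha hb
      rw [Finset.mem_Icc] at ha hb
      omega) fun i => measurable_pi_apply i
  have h1 := hind.comp
    (φ := fun (w : Finset.Icc (-m : ℤ) m → Fin 2) (i : Fin (2 * m + 1)) => 
      w ⟨(i : ℤ) - m, by rw [Finset.mem_Icc]; omega⟩)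
    (ψ := fun (w : Finset.Icc (m + 1 : ℤ) (3 * m + 1) → Fin 2) (i : Fin (2 * m + 1)) => 
      w ⟨(i : ℤ) + m + 1, by rw [Finset.mem_Icc]; omega⟩)
    (measurable_of_finite _) (measurable_of_finite _)
  have h2 := h1.measure_inter_preimage_eq_mul S S S.toFinite.measurableSet S.toFinite.measurableSet
  have hT := (show MeasurePreserving shift _ _ from bernoulliHalf_mem_invariantMeasures).iterate
    (2 * m + 1)
  have e2 : (fun (x : ℤ → Fin 2) (i : Fin (2 * m + 1)) => x ((i : ℤ) + m + 1)) ⁻¹' S =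
      shift^[2 * m + 1] ⁻¹' (window m ⁻¹' S) := by
    rw [← preimage_comp]
    congr 1
    funext x i
    simp only [Function.comp_apply, window, shift_iterate_apply]
    congr 1
    push_cast
    ring
  have h3 : (bernoulliHalf : Measure (ℤ → Fin 2))
      (window m ⁻¹' S ∩ shift^[2 * m + 1] ⁻¹' (window m ⁻¹' S)) =
      (bernoulliHalf : Measure (ℤ → Fin 2)) (window m ⁻¹' S) *
      (bernoulliHalf : Measure (ℤ → Fin 2)) (shift^[2 * m + 1] ⁻¹' (window m ⁻¹' S)) := by
    rw [← e2]
    exact h2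
  rw [hT.measure_preimage (isClopen_window_preimage m S).isOpen.measurableSet.nullMeasurableSet] at h3
  rw [Measure.real, h3, ENNReal.toReal_mul, sq]
  rfl

lemma bernoulliHalf_mem_ergodicMeasures : bernoulliHalf ∈ ergodicMeasures shift := by
  have hT : MeasurePreserving shift (bernoulliHalf : Measure (ℤ → Fin 2)) bernoulliHalf :=
    bernoulliHalf_mem_invariantMeasures
  refine ⟨hT, ⟨fun A hA hinv => ?_⟩⟩
  set μ : Measure (ℤ → Fin 2) := (bernoulliHalf : Measure (ℤ → Fin 2))
  -- Approximate `A` by a window event `B`. By invariance of `A`, `B ∩ f ⁻¹' B` is also close to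
  -- `A`, while its mass is that of `B` squared.
  have hsq : μ.real A = μ.real A ^ 2 := by
    refine eq_of_forall_dist_le fun ε hε => ?_
    obtain ⟨m, S, hS⟩ := exists_window_symmDiff_lt μ hA (ε := ε / 4) (by positivity)
    set B := window m ⁻¹' S
    have hB : MeasurableSet B := (isClopen_window_preimage m S).isOpen.measurableSet
    set f := shift^[2 * m + 1]
    have hf : MeasurePreserving f μ μ := hT.iterate _
    have hfA : f ⁻¹' A = A := by
      have : ∀ n : ℕ, shift^[n] ⁻¹' A = A := by
        intro n
        induction n with
        | zero => rfl
        | succ n ih => rw [Function.iterate_succ', preimage_comp, hinv, ih]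
      exact this _
    have h1 : |μ.real B - μ.real A| ≤ ε / 4 :=
      (abs_measureReal_sub_le_measureReal_symmDiff hB.nullMeasurableSet hA.nullMeasurableSet).trans hS.le
    have hsub : symmDiff (B ∩ f ⁻¹' B) A ⊆ symmDiff B A ∪ f ⁻¹' (symmDiff B A) := by
      intro x hx
      have hx' : f x ∈ A ↔ x ∈ A := by rw [← mem_preimage, hfA]
      simp only [Set.mem_symmDiff, mem_union, mem_inter_iff, mem_preimage, hx'] at hx ⊢
      tauto
    have h2 : |μ.real (B ∩ f ⁻¹' B) - μ.real A| ≤ ε / 2 := by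
      refine (abs_measureReal_sub_le_measureReal_symmDiff
        (hB.inter (hf.measurable hB)).nullMeasurableSet hA.nullMeasurableSet).trans ?_
      refine (measureReal_mono hsub).trans ((measureReal_union_le _ _).trans ?_)
      rw [hf.measureReal_preimage (hB.symmDiff hA).nullMeasurableSet]
      linarith
    rw [bernoulliHalf_real_inter] at h2
    have hA1 : μ.real A ≤ 1 := measureReal_le_one
    have hB1 : μ.real B ≤ 1 := measureReal_le_one
    have hA0 : 0 ≤ μ.real A := measureReal_nonneg
    have hB0 : 0 ≤ μ.real B := measureReal_nonneg
    rw [Real.dist_eq]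
    change |μ.real B ^ 2 - μ.real A| ≤ ε / 2 at h2
    rw [abs_le] at h1 h2 ⊢
    constructor <;> nlinarith
  rw [eventuallyConst_set']
  have : μ.real A * (μ.real A - 1) = 0 := by linarith
  rcases mul_eq_zero.1 this with h | h
  · left
    rw [ae_eq_empty]
    exact (measureReal_eq_zero_iff).1 h
  · right
    rw [ae_eq_univ, ← measureReal_eq_zero_iff, probReal_compl_eq_one_sub hA]
    linarith

end Bernoulli

/-! ### Maximal-length sequences and convergence to the Bernoulli measure. -/

section MaximalLengthSequence

/-- The powers of a generator of the unit group of a finite field of `2 ^ n` elements that lie below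
the `n`-th span the field over its prime field. -/
lemma span_pow_eq_top {n : ℕ} (hn : n ≠ 0) {u : (GaloisField 2 n)ˣ}
    (hu : ∀ v, v ∈ Subgroup.zpowers u) :
    Submodule.span (ZMod 2) (range fun j : Fin n => (u : GaloisField 2 n) ^ (j : ℕ)) = ⊤ := by
  have hint : IsIntegral (ZMod 2) (u : GaloisField 2 n) := Algebra.IsIntegral.isIntegral _
  have hadj : Algebra.adjoin (ZMod 2) {(u : GaloisField 2 n)} = ⊤ := by
    refine eq_top_iff.2 fun z _ => ?_
    rcases eq_or_ne z 0 with rfl | hz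
    · exact zero_mem _
    · obtain ⟨i, hi⟩ := mem_powers_iff_mem_zpowers.2 (hu (Units.mk0 z hz))
      have : z = (u : GaloisField 2 n) ^ i := by
        have := congrArg Units.val hi
        simpa using this.symm
      rw [this]
      exact pow_mem (Algebra.self_mem_adjoin_singleton _ _) _
  have hspan := Submodule.span_range_natDegree_eq_adjoin (minpoly.monic hint) (minpoly.aeval _ _)
  rw [hadj, Algebra.top_toSubmodule] at hspan
  rw [← top_le_iff, ← hspan]
  refine Submodule.span_mono ?_
  intro z hz
  simp only [Finset.coe_image, Finset.coe_range, mem_image, mem_Iio] at hz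
  obtain ⟨i, hi, rfl⟩ := hz
  have hdeg := minpoly.natDegree_le (A := ZMod 2) (u : GaloisField 2 n)
  rw [GaloisField.finrank 2 hn] at hdeg
  exact ⟨⟨i, hi.trans_le hdeg⟩, rfl⟩

/-- There is a binary sequence of period `2 ^ n - 1` in which each nonzero word of length `n` occurs
exactly once per period, and the zero word does not occur. -/
lemma exists_maximalLengthSequence {n : ℕ} (hn : n ≠ 0) : ∃ x : ℤ → Fin 2,
    Function.IsPeriodicPt shift (2 ^ n - 1) x ∧
    BijOn (fun (i : ℕ) (j : Fin n) => x (j + i)) (Iio (2 ^ n - 1)) {w | w ≠ 0} := by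
  have hcard : Nat.card (GaloisField 2 n) = 2 ^ n := GaloisField.card 2 n hn
  have : Fintype (GaloisField 2 n) := Fintype.ofFinite _
  obtain ⟨u, hu⟩ := IsCyclic.exists_generator (α := (GaloisField 2 n)ˣ)
  have hord : orderOf u = 2 ^ n - 1 := by
    rw [orderOf_eq_card_of_forall_mem_zpowers hu, Nat.card_units, hcard]
  obtain ⟨l, hl⟩ : ∃ l : Module.Dual (ZMod 2) (GaloisField 2 n), l 1 ≠ 0 := by
    by_contra! h
    exact one_ne_zero ((Module.forall_dual_apply_eq_zero_iff (ZMod 2) (1 : GaloisField 2 n)).1 h)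
  let L : GaloisField 2 n →ₗ[ZMod 2] (Fin n → ZMod 2) :=
    LinearMap.pi fun j => l ∘ₗ LinearMap.mulRight (ZMod 2) ((u : GaloisField 2 n) ^ (j : ℕ))
  have hL : ∀ y j, L y j = l (y * (u : GaloisField 2 n) ^ (j : ℕ)) := fun _ _ => rfl
  have hinj : Function.Injective L := by
    rw [injective_iff_map_eq_zero]
    intro y hy
    by_contra hy0
    -- `L y = 0` says that `l (y * ·)` kills the powers of `u` below `n`, which span the field; at
    -- `y⁻¹` this contradicts `l 1 ≠ 0`.
    have hker : ∀ z, l (y * z) = 0 := by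
      intro z
      have hz : z ∈ Submodule.span (ZMod 2)
          (range fun j : Fin n => (u : GaloisField 2 n) ^ (j : ℕ)) := by
        rw [span_pow_eq_top hn hu]; trivial
      induction hz using Submodule.span_induction with
      | mem z hz =>
        obtain ⟨j, rfl⟩ := hz
        exact congrFun hy j
      | zero => simp
      | add a b _ _ ha hb => rw [mul_add, map_add, ha, hb, add_zero]
      | smul c a _ ha => rw [mul_smul_comm, map_smul, ha, smul_zero]
    exact hl (by simpa [hy0] using hker y⁻¹)
  have hsurj : Function.Surjective L := by
    refine ((Fintype.bijective_iff_injective_and_card L).2 ⟨hinj, ?_⟩).2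
    rw [← Nat.card_eq_fintype_card, hcard]
    simp
  -- `ZMod 2` unfolds to `Fin 2`. The word of length `n` at position `i` is `L (u ^ i)`, and `u ^ i`
  -- runs once through the nonzero elements in a period.
  let x : ℤ → Fin 2 := fun i => l ((u ^ i : (GaloisField 2 n)ˣ) : GaloisField 2 n)
  have hx : ∀ i : ℕ, (fun j : Fin n => x (j + i)) =
      L ((u ^ i : (GaloisField 2 n)ˣ) : GaloisField 2 n) := by
    intro i
    funext j
    rw [hL]
    change l _ = _
    congr 1
    rw [zpow_add, mul_comm]
    simp
  refine ⟨x, ?_, ?_, ?_, ?_⟩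
  · funext i
    rw [shift_iterate_apply]
    change l _ = l _
    rw [zpow_add, zpow_natCast, ← hord, pow_orderOf_eq_one, mul_one]
  · intro i _
    change (fun j : Fin n => x (j + i)) ≠ 0
    rw [hx]
    exact (map_ne_zero_iff L hinj).2 (Units.ne_zero _)
  · intro i hi i' hi' h
    change (fun j : Fin n => x (j + i)) = (fun j : Fin n => x (j + i')) at h
    rw [hx, hx] at h
    rw [← hord] at hi hi'
    exact pow_injOn_Iio_orderOf hi hi' (Units.ext (hinj h))
  · intro w hw
    obtain ⟨y, rfl⟩ := hsurj w
    have hy : y ≠ 0 := (map_ne_zero_iff L hinj).1 hw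
    obtain ⟨i, hi⟩ := mem_powers_iff_mem_zpowers.2 (hu (Units.mk0 y hy))
    refine ⟨i % orderOf u, ?_, ?_⟩
    · rw [mem_Iio, ← hord]
      exact Nat.mod_lt _ (orderOf_pos u)
    · change (fun j : Fin n => x (j + ((i % orderOf u : ℕ) : ℤ))) = _
      rw [hx, pow_mod_orderOf]
      change u ^ i = _ at hi
      rw [hi, Units.val_mk0]

/-- The first `n` coordinates of `x` with nonnegative index. -/
def block (n : ℕ) (x : ℤ → Fin 2) : Fin n → Fin 2 := fun j => x j

lemma measurable_block (n : ℕ) : Measurable (block n) :=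
  measurable_pi_lambda _ fun _ => measurable_pi_apply _

lemma measurableSet_block_preimage (n : ℕ) (S : Set (Fin n → Fin 2)) :
    MeasurableSet (block n ⁻¹' S) := measurable_block n S.toFinite.measurableSet

open Classical in
lemma two_pow_mul_bernoulliHalf_real_block (n : ℕ) (S : Set (Fin n → Fin 2)) :
    2 ^ n * (bernoulliHalf : Measure (ℤ → Fin 2)).real (block n ⁻¹' S) = S.toFinset.card := by
  have hinj : Function.Injective fun j : Fin n => ((j : ℕ) : ℤ) := fun i j h => by
    ext; simpa using h
  have h := sum_measureReal_preimage_singleton (μ := (bernoulliHalf : Measure (ℤ → Fin 2)))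
    (f := block n) S.toFinset fun w _ => measurable_block n (measurableSet_singleton w)
  rw [coe_toFinset] at h
  have hw : ∀ w, (bernoulliHalf : Measure (ℤ → Fin 2)).real (block n ⁻¹' {w}) = (2 ^ n)⁻¹ :=
    fun w => (bernoulliHalf_real_singleton hinj w).trans (by rw [Fintype.card_fin])
  rw [← h, Finset.sum_congr rfl fun w _ => hw w]
  simp [mul_comm]

open Classical in
/-- A periodic orbit measure giving mass `1 / (2 ^ n - 1)` to each cylinder of a nonzero word of
length `n`. -/
lemma exists_isPeriodicOrbitMeasure_block {n : ℕ} (hn : n ≠ 0) :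
    ∃ ν : ProbabilityMeasure (ℤ → Fin 2), IsPeriodicOrbitMeasure shift ν ∧
      ∀ M ≤ n, ∀ S : Set (Fin M → Fin 2),
        (2 ^ n - 1) * (ν : Measure (ℤ → Fin 2)).real (block M ⁻¹' S) =
          2 ^ n * (bernoulliHalf : Measure (ℤ → Fin 2)).real (block M ⁻¹' S) -
            if 0 ∈ S then 1 else 0 := by
  obtain ⟨x, hper, hbij⟩ := exists_maximalLengthSequence hn
  set p := 2 ^ n - 1 with hp
  have h2n : 1 < 2 ^ n := Nat.one_lt_two_pow hn
  have hp0 : 0 < p := by omega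
  have hpR : (2 ^ n - 1 : ℝ) = p := by
    rw [hp, Nat.cast_sub h2n.le]; simp
  have hp0' : (p : ℝ) ≠ 0 := by exact_mod_cast hp0.ne'
  let m : Measure (ℤ → Fin 2) :=
    (p : ℝ≥0∞)⁻¹ • ∑ i ∈ Finset.range p, Measure.dirac (shift^[i] x)
  have hm : IsProbabilityMeasure m := ⟨by
    simp only [m, Measure.smul_apply, Measure.finsetSum_apply, measure_univ, Finset.sum_const,
      Finset.card_range, nsmul_eq_mul, mul_one, smul_eq_mul]
    exact ENNReal.inv_mul_cancel (by exact_mod_cast hp0.ne') (ENNReal.natCast_ne_top p)⟩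
  refine ⟨⟨m, hm⟩, ⟨x, p, hp0, hper, rfl⟩, ?_⟩
  have hfull : ∀ S : Set (Fin n → Fin 2), (2 ^ n - 1) * m.real (block n ⁻¹' S) =
      2 ^ n * (bernoulliHalf : Measure (ℤ → Fin 2)).real (block n ⁻¹' S) -
        if 0 ∈ S then 1 else 0 := by
    intro S
    have hreal : m.real (block n ⁻¹' S) = _ :=
      orbitMeasure_real_apply (ν := ⟨m, hm⟩) rfl (measurableSet_block_preimage n S)
    rw [two_pow_mul_bernoulliHalf_real_block, hpR, hreal, mul_inv_cancel_left₀ hp0']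
    have hblock : ∀ i, block n (shift^[i] x) = fun j : Fin n => x (j + i) := fun i =>
      funext fun j => shift_iterate_apply i x j
    have hcard : Finset.card {i ∈ Finset.range p | shift^[i] x ∈ block n ⁻¹' S} =
        (S.toFinset.erase 0).card := by
      refine Finset.card_bij (fun i _ => block n (shift^[i] x)) ?_ ?_ ?_
      · intro i hi
        rw [Finset.mem_filter, Finset.mem_range] at hi
        rw [Finset.mem_erase, mem_toFinset, hblock]
        exact ⟨hbij.mapsTo hi.1, by simpa [hblock] using hi.2⟩
      · intro i hi i' hi' h
        rw [Finset.mem_filter, Finset.mem_range] at hi hi'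
        rw [hblock, hblock] at h
        exact hbij.injOn hi.1 hi'.1 h
      · intro w hw
        rw [Finset.mem_erase, mem_toFinset] at hw
        obtain ⟨i, hi, hiw⟩ := hbij.surjOn hw.1
        refine ⟨i, ?_, (hblock i).trans hiw⟩
        rw [Finset.mem_filter, Finset.mem_range, mem_preimage, (hblock i).trans hiw]
        exact ⟨hi, hw.2⟩
    rw [hcard]
    split_ifs with h0
    · rw [Finset.cast_card_erase_of_mem (by simpa using h0)]
    · rw [Finset.erase_eq_of_notMem (by simpa using h0), sub_zero]
  intro M hM S
  -- Truncating the zero word gives the zero word, so the correction term is the same at length `M`.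
  have hS : block M ⁻¹' S = block n ⁻¹' {w | (fun j : Fin M => w (j.castLE hM)) ∈ S} := rfl
  rw [hS]
  exact hfull _

/-- Periodic orbit measures exist arbitrarily close to the Bernoulli measure. -/
lemma exists_injective_periodicOrbitMeasure_tendsto :
    ∃ δ : ℕ → ProbabilityMeasure (ℤ → Fin 2), Function.Injective δ ∧
      (∀ n, IsPeriodicOrbitMeasure shift (δ n)) ∧ Tendsto δ atTop (𝓝 bernoulliHalf) := by
  classical
  choose δ hδ hblock using fun n : ℕ => exists_isPeriodicOrbitMeasure_block n.succ_ne_zero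
  have hpow : ∀ n : ℕ, (1 : ℝ) < 2 ^ n.succ := fun n => one_lt_pow₀ one_lt_two n.succ_ne_zero
  -- The zero word of length `n + 1` has mass zero under `δ n` but positive mass under the later `δ
  -- n'`.
  have hne : ∀ n n', n < n' → δ n ≠ δ n' := by
    intro n n' hnn' heq
    have h1 := hblock n n.succ le_rfl {0}
    have h2 := hblock n' n.succ (Nat.succ_le_succ hnn'.le) {0}
    have h3 := two_pow_mul_bernoulliHalf_real_block n.succ {0}
    simp only [toFinset_singleton, Finset.card_singleton, Nat.cast_one] at h3
    simp only [mem_singleton_iff, if_true] at h1 h2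
    rw [h3, sub_self, mul_eq_zero, or_iff_right (sub_pos.2 (hpow n)).ne'] at h1
    rw [← heq, h1, mul_zero] at h2
    have h4 : (2 : ℝ) ^ n.succ < 2 ^ n'.succ := pow_lt_pow_right₀ one_lt_two (by omega)
    have h5 : 0 < (bernoulliHalf : Measure (ℤ → Fin 2)).real (block n.succ ⁻¹' {0}) := by
      by_contra! h
      nlinarith [hpow n]
    nlinarith
  refine ⟨δ, fun n n' h => ?_, hδ, ?_⟩
  · by_contra hnn'
    exact (Ne.lt_or_gt hnn').elim (fun hlt => hne _ _ hlt h) fun hlt => hne _ _ hlt h.symm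
  · have hpi := isPiSystem_measurableCylinders (α := fun _ : ℤ => Fin 2)
    refine hpi.tendsto_probabilityMeasure_of_tendsto_of_mem
      (fun s hs => MeasurableSet.of_mem_measurableCylinders hs) ?_ ?_
    · intro U hU x hx
      obtain ⟨I, V, hV, hVU⟩ := isOpen_pi_iff.1 hU x hx
      refine ⟨_, cylinder_mem_measurableCylinders (α := fun _ : ℤ => Fin 2) I {I.restrict x} (measurableSet_singleton _),
        ?_, ?_⟩
      · have hc : Continuous (I.restrict : (ℤ → Fin 2) → _) := by fun_prop
        exact ((isOpen_discrete _).preimage hc).mem_nhds rfl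
      · intro y hy
        refine hVU fun i hi => ?_
        have : y i = x i := congrFun (mem_singleton_iff.1 ((mem_cylinder _ _ _).1 hy)) ⟨i, hi⟩
        rw [this]
        exact (hV i hi).2
    · intro t ht
      obtain ⟨m, S, rfl⟩ := exists_window_preimage_of_mem_measurableCylinders ht
      have hW := (isClopen_window_preimage m S).isOpen.measurableSet
      have hshift : shift^[m] ⁻¹' (window m ⁻¹' S) = block (2 * m + 1) ⁻¹' S := by
        rw [← preimage_comp]
        congr 1
        funext x i
        simp [window, block, shift_iterate_apply]
      have hinv : ∀ ν ∈ invariantMeasures shift, (ν : Measure (ℤ → Fin 2)).real (window m ⁻¹' S) =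
          (ν : Measure (ℤ → Fin 2)).real (block (2 * m + 1) ⁻¹' S) := by
        intro ν hν
        have hT : MeasurePreserving shift (ν : Measure (ℤ → Fin 2)) ν := hν
        rw [← hshift, (hT.iterate m).measureReal_preimage hW.nullMeasurableSet]
      rw [← NNReal.tendsto_coe]
      change Tendsto (fun n => (δ n : Measure (ℤ → Fin 2)).real (window m ⁻¹' S)) atTop
        (𝓝 ((bernoulliHalf : Measure (ℤ → Fin 2)).real (window m ⁻¹' S)))
      have hmeas : Measurable shift := shift.continuous.measurable
      rw [hinv _ bernoulliHalf_mem_invariantMeasures]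
      simp only [hinv _ ((hδ _).mem_invariantMeasures hmeas)]
      set c := (bernoulliHalf : Measure (ℤ → Fin 2)).real (block (2 * m + 1) ⁻¹' S)
      set e : ℝ := if 0 ∈ S then 1 else 0
      have hr : Tendsto (fun n : ℕ => (2 : ℝ) ^ n.succ - 1) atTop atTop :=
        tendsto_atTop_add_const_right _ _
          ((tendsto_pow_atTop_atTop_of_one_lt one_lt_two).comp (tendsto_add_atTop_nat 1))
      -- For large `n` the mass under `δ n` is exactly `c + (c - e) / (2 ^ (n + 1) - 1)`.
      have hlim := (hr.const_div_atTop (c - e)).const_add c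
      rw [add_zero] at hlim
      refine hlim.congr' ?_
      filter_upwards [eventually_ge_atTop (2 * m)] with n hn
      have h1 := hblock n (2 * m + 1) (Nat.succ_le_succ hn) S
      have h2 := (sub_pos.2 (hpow n)).ne'
      field_simp
      linarith

end MaximalLengthSequence

/-! ### The entropy jump excludes a common potential. -/

section EquilibriumFace

lemma subset_closedConvexHull {X : Type*} [MeasurableSpace X] [TopologicalSpace X]
    [OpensMeasurableSpace X] (E : Set (ProbabilityMeasure X)) : E ⊆ closedConvexHull E :=
  fun _ hν => subset_closure (subset_convexHull _ _ (mem_image_of_mem _ hν))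

/-- Equilibrium states `δ n` of zero entropy converging to an equilibrium state `μ` force `μ` to
have zero entropy. -/
lemma entropy_eq_zero_of_tendsto_equilibriumStates {X : Type*} [MeasurableSpace X]
    [TopologicalSpace X] [CompactSpace X] [OpensMeasurableSpace X] {T : X → X} {φ : C(X, ℝ)}
    {δ : ℕ → ProbabilityMeasure X} {μ : ProbabilityMeasure X} (hlim : Tendsto δ atTop (𝓝 μ))
    (hδ : ∀ n, δ n ∈ equilibriumStates T φ) (hδ0 : ∀ n, entropy T (δ n) = 0)
    (hμ : μ ∈ equilibriumStates T φ) : entropy T μ = 0 := by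
  have hint : Tendsto (fun n => ∫ x, φ x ∂(δ n : Measure X)) atTop
      (𝓝 (∫ x, φ x ∂(μ : Measure X))) :=
    (ProbabilityMeasure.tendsto_iff_forall_integral_tendsto.1 hlim)
      (BoundedContinuousFunction.mkOfCompact φ)
  have hint' := (continuous_coe_real_ereal.tendsto _).comp hint
  have hP : ∀ n, ((∫ x, φ x ∂(δ n : Measure X) : ℝ) : EReal) = pressure T φ := by
    intro n
    rw [← (hδ n).2, hδ0, zero_add]
  have hP' : ((∫ x, φ x ∂(μ : Measure X) : ℝ) : EReal) = pressure T φ :=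
    tendsto_nhds_unique hint' (by simp only [Function.comp_def, hP]; exact tendsto_const_nhds)
  have h := hμ.2
  rw [← hP'] at h
  set r : ℝ := ∫ x, φ x ∂(μ : Measure X)
  induction hh : entropy T μ with
  | bot => rw [hh] at h; simp at h
  | top => rw [hh] at h; simp at h
  | coe a =>
    rw [hh, ← EReal.coe_add, EReal.coe_eq_coe_iff] at h
    rw [← EReal.coe_zero, EReal.coe_eq_coe_iff]
    linarith

variable {δ : ℕ → ProbabilityMeasure (ℤ → Fin 2)}

lemma entropy_bernoulliHalf_ne_zero : entropy shift bernoulliHalf ≠ 0 := by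
  rw [entropy_bernoulliHalf, ← EReal.coe_zero, Ne, EReal.coe_eq_coe_iff]
  exact (Real.log_pos one_lt_two).ne'

lemma periodicOrbitMeasures_union_bernoulliHalf
    (hper : ∀ n, IsPeriodicOrbitMeasure shift (δ n)) (hlim : Tendsto δ atTop (𝓝 bernoulliHalf)) :
    range δ ∪ {bernoulliHalf} ⊆ ergodicMeasures shift ∧
      IsClosed (range δ ∪ {bernoulliHalf}) ∧
      ¬ ContinuousOn (entropy shift) (range δ ∪ {bernoulliHalf}) ∧
      ∀ φ : C(ℤ → Fin 2, ℝ),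
        equilibriumStates shift φ ≠ closedConvexHull (range δ ∪ {bernoulliHalf}) := by
  have hT : Measurable shift := shift.continuous.measurable
  have h0 : ∀ n, entropy shift (δ n) = 0 := fun n => (hper n).entropy_eq_zero hT
  have hmem : ∀ n, δ n ∈ range δ ∪ {bernoulliHalf} := fun n => .inl (mem_range_self n)
  have hmem' : bernoulliHalf ∈ range δ ∪ {bernoulliHalf} := .inr rfl
  refine ⟨?_, ?_, fun hcont => ?_, fun φ hφ => ?_⟩
  · rintro _ (⟨n, rfl⟩ | rfl)
    exacts [(hper n).mem_ergodicMeasures hT, bernoulliHalf_mem_ergodicMeasures]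
  · rw [union_singleton]
    -- A convergent sequence together with its limit is compact, hence closed in a Hausdorff space.
    exact hlim.isCompact_insert_range.isClosed
  · have h1 : Tendsto (fun n => entropy shift (δ n)) atTop (𝓝 (entropy shift bernoulliHalf)) :=
      (hcont _ hmem').tendsto.comp
        (tendsto_nhdsWithin_iff.2 ⟨hlim, Eventually.of_forall hmem⟩)
    simp only [h0] at h1
    exact entropy_bernoulliHalf_ne_zero (tendsto_nhds_unique h1 tendsto_const_nhds)
  · have hsub := subset_closedConvexHull (range δ ∪ {bernoulliHalf})
    rw [← hφ] at hsub
    exact entropy_bernoulliHalf_ne_zero (entropy_eq_zero_of_tendsto_equilibriumStates hlim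
      (fun n => hsub (hmem n)) h0 (hsub hmem'))

end EquilibriumFace

end Thermo

theorem mainTheorem10 :
    -- the entropy map of the full 2-shift is weak-* upper semicontinuous
    UpperSemicontinuousOn (Thermo.entropy Thermo.shift) (Thermo.invariantMeasures Thermo.shift) ∧
    -- sequences of distinct periodic orbit measures converging to the Bernoulli measure exist
    (∃ δ : ℕ → ProbabilityMeasure (ℤ → Fin 2), Function.Injective δ ∧
      (∀ n, Thermo.IsPeriodicOrbitMeasure Thermo.shift (δ n)) ∧
      Tendsto δ atTop (𝓝 Thermo.bernoulliHalf)) ∧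
    -- and every such sequence has the stated properties
    (∀ δ : ℕ → ProbabilityMeasure (ℤ → Fin 2), Function.Injective δ →
      (∀ n, Thermo.IsPeriodicOrbitMeasure Thermo.shift (δ n)) →
      Tendsto δ atTop (𝓝 Thermo.bernoulliHalf) →
      ∀ E : Set (ProbabilityMeasure (ℤ → Fin 2)), E = range δ ∪ {Thermo.bernoulliHalf} →
        E ⊆ Thermo.ergodicMeasures Thermo.shift ∧
        IsClosed E ∧
        (∀ n, Thermo.entropy Thermo.shift (δ n) = 0) ∧
        Thermo.entropy Thermo.shift Thermo.bernoulliHalf = ((Real.log 2 : ℝ) : EReal) ∧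
        ¬ ContinuousOn (Thermo.entropy Thermo.shift) E ∧
        ∀ φ : C(ℤ → Fin 2, ℝ),
          Thermo.equilibriumStates Thermo.shift φ ≠ Thermo.closedConvexHull E) ∧
    -- hence the face realization claim without a continuity hypothesis is false
    ¬ Thermo.FaceRealization := by
  obtain ⟨δ, hinj, hper, hlim⟩ := Thermo.exists_injective_periodicOrbitMeasure_tendsto
  refine ⟨Thermo.upperSemicontinuousOn_entropy_shift, ⟨δ, hinj, hper, hlim⟩, ?_, fun hface => ?_⟩
  · rintro δ - hper hlim E rfl
    obtain ⟨herg, hclosed, hcont, hne⟩ :=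
      Thermo.periodicOrbitMeasures_union_bernoulliHalf hper hlim
    exact ⟨herg, hclosed,
      fun n => (hper n).entropy_eq_zero Thermo.shift.continuous.measurable,
      Thermo.entropy_bernoulliHalf, hcont, hne⟩
  · obtain ⟨herg, hclosed, -, hne⟩ :=
      Thermo.periodicOrbitMeasures_union_bernoulliHalf hper hlim
    obtain ⟨φ, hφ⟩ := hface (ℤ → Fin 2) Thermo.shift
      ⟨Real.log 2, fun ν hν => Thermo.entropy_shift_le_log_two hν⟩
      Thermo.upperSemicontinuousOn_entropy_shift _ herg ⟨_, .inr rfl⟩ hclosed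
    exact hne φ hφ
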